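/- Let $F \in \mathbb{Z}[x,y]$ be of the form $$F(x,y) = a_4 H(x,y)^4 + H(x,y)^2 G_3(x,y) + F_2(x,y) + F_1(x,y),$$ where $a_4$ is a positive integer, $H \in \mathbb{Z}[x,y]$ is a primitive linear form (a linear form whose coefficients have greatest common divisor $1$), $G_3 \in \mathbb{Z}[x,y]$ is a linear form that is not divisible by $H$ (in particular $G_3 \neq 0$), and $F_2, F_1 \in \mathbb{Z}[x,y]$ are arbitrary forms of degree $2$ and $1$ respectively, each possibly the zero polynomial. Then either $$\#\bigl(F(\mathbb{Z}^2) \cap [N, 2N]\bigr) \ll \frac{N}{\sqrt{\log N}}$$ for all sufficiently large positive integers $N$, where the implied constant may depend on $F$, or $$\inf_{(x,y) \in \mathbb{Z}^2} F(x,y) = -\infty.$$ -/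

import Mathlib

open Filter Asymptotics MvPolynomial

/-- An integral form (or polynomial) is primitive if the greatest common divisor of its
coefficients is `1`. In particular the zero polynomial is not primitive. -/
def IsPrimitiveForm (H : MvPolynomial (Fin 2) ℤ) : Prop :=
  H.support.gcd (fun m => H.coeff m) = 1

/-- The value `F (x, y)` for `(x, y) ∈ ℤ²`. -/
noncomputable def intValue (F : MvPolynomial (Fin 2) ℤ) (p : ℤ × ℤ) : ℤ :=
  MvPolynomial.eval ![p.1, p.2] F

/-- `F (ℤ²) ∩ B`, the set of values of `F` on `ℤ²` that lie in `B ⊆ ℝ`. -/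
def valuesIn (F : MvPolynomial (Fin 2) ℤ) (B : Set ℝ) : Set ℝ :=
  (Set.range fun p : ℤ × ℤ => (intValue F p : ℝ)) ∩ B

/-! A unimodular change of variables turns `H` into `x` and `F` into `normalQuartic`, where `c ≠ 0`
because `H ∤ G₃`. Suppose `F` is bounded below. Then the coefficient `f` of `y ^ 2` is positive, and
completing the square gives `4 f F = Z ^ 2 + P(x)` with `P` of degree at most 4. Since `y` can be
chosen to keep `Z` bounded, `P` is bounded below as well, so it is constant or has even degree and
positive leading coefficient.

If `P` is quartic, then `F ≤ 2N` forces `x ≪ N^(1/4)` and `Z ≪ N^(1/2)`, leaving `O(N^(3/4))`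
values; a constant `P` leaves even fewer. If `P` is quadratic, a second completed square makes a
fixed affine function of `F` a value of `u ^ 2 + D w ^ 2`, and `exists_card_rep_le` supplies
Landau's bound `X / √(log X)`.

That bound is proved elementarily. A represented number is a square times a squarefree `s` with no
prime factor inert for `χ = (-D | ·)`. The square of the reciprocal sum over products of split
primes is dominated by `∑ (χ * 1)(n) / n ≪ log X`, so `∑ 1 / s ≪ √(log X)`. Weighting the count by
`log s` and using Chebyshev's bound then saves `√(log X)`. -/

/-- Abel's inequality for antitone nonnegative weights. -/
theorem sum_range_mul_le_of_antitone {c g : ℕ → ℝ} {M : ℝ} (hc : Antitone c) (hc0 : ∀ n, 0 ≤ c n)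
    (hg : ∀ n, ∑ i ∈ Finset.range n, g i ≤ M) (n : ℕ) :
    ∑ i ∈ Finset.range n, c i * g i ≤ M * c 0 := by
  have hM : 0 ≤ M := by simpa using hg 0
  rcases Nat.eq_zero_or_pos n with rfl | hn
  · simpa using mul_nonneg hM (hc0 0)
  have h := Finset.sum_range_by_parts c g n
  simp only [smul_eq_mul] at h
  rw [h]
  have h1 : c (n - 1) * ∑ i ∈ Finset.range n, g i ≤ c (n - 1) * M :=
    mul_le_mul_of_nonneg_left (hg n) (hc0 _)
  have h2 : ∑ i ∈ Finset.range (n - 1), (c (i + 1) - c i) * M ≤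
      ∑ i ∈ Finset.range (n - 1), (c (i + 1) - c i) * ∑ j ∈ Finset.range (i + 1), g j :=
    Finset.sum_le_sum fun i _ =>
      mul_le_mul_of_nonpos_left (hg _) (sub_nonpos.2 (hc (Nat.le_succ i)))
  rw [← Finset.sum_mul, Finset.sum_range_sub] at h2
  linarith

/-! ### The character `(-D | ·)` and its partial sums -/

/-- The Kronecker-type character `n ↦ (-D | n)` on odd `n`, extended by `0` to even `n`. -/
def negJacobi (D n : ℕ) : ℤ := if Even n then 0 else jacobiSym (-(D : ℤ)) n

theorem negJacobi_of_odd {D n : ℕ} (hn : Odd n) : negJacobi D n = jacobiSym (-(D : ℤ)) n := by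
  rw [negJacobi, if_neg (Nat.not_even_iff_odd.2 hn)]

theorem negJacobi_of_even {D n : ℕ} (hn : Even n) : negJacobi D n = 0 := if_pos hn

theorem negJacobi_one (D : ℕ) : negJacobi D 1 = 1 := by
  rw [negJacobi_of_odd odd_one, jacobiSym.one_right]

theorem negJacobi_mul (D m n : ℕ) : negJacobi D (m * n) = negJacobi D m * negJacobi D n := by
  rcases Nat.even_or_odd m with hm | hm
  · rw [negJacobi_of_even hm, negJacobi_of_even (hm.mul_right n), zero_mul]
  rcases Nat.even_or_odd n with hn | hn
  · rw [negJacobi_of_even hn, negJacobi_of_even (hn.mul_left m), mul_zero]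
  · rw [negJacobi_of_odd hm, negJacobi_of_odd hn, negJacobi_of_odd (hm.mul hn),
      jacobiSym.mul_right' _ hm.pos.ne' hn.pos.ne']

theorem negJacobi_pow (D m k : ℕ) : negJacobi D (m ^ k) = negJacobi D m ^ k := by
  induction k with
  | zero => simp [negJacobi_one]
  | succ k ih => rw [pow_succ, negJacobi_mul, ih, pow_succ]

theorem negJacobi_trichotomy (D n : ℕ) :
    negJacobi D n = 0 ∨ negJacobi D n = 1 ∨ negJacobi D n = -1 := by
  unfold negJacobi
  split_ifs
  · exact Or.inl rfl
  · exact jacobiSym.trichotomy _ _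

theorem abs_negJacobi_le_one (D n : ℕ) : |negJacobi D n| ≤ 1 := by
  rcases negJacobi_trichotomy D n with h | h | h <;> simp [h]

theorem negJacobi_congr {D m n : ℕ} (h : m % (4 * D) = n % (4 * D)) :
    negJacobi D m = negJacobi D n := by
  have h2 : m % 2 = n % 2 := by
    have : 2 ∣ 4 * D := ⟨2 * D, by ring⟩
    rw [← Nat.mod_mod_of_dvd m this, h, Nat.mod_mod_of_dvd n this]
  rcases Nat.even_or_odd m with hm | hm
  · rw [negJacobi_of_even hm, negJacobi_of_even (by grind)]
  · have hn : Odd n := by grind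
    rw [negJacobi_of_odd hm, negJacobi_of_odd hn, jacobiSym.mod_right _ hm,
      jacobiSym.mod_right _ hn]
    simp [h]

/-- The character is odd: `4D ≡ 1` modulo `4D - 1` makes `(D | 4D - 1) = 1`, while `(-1 | 4D - 1) =
-1`. Oddness makes the sum over a period vanish, with no need to know that the character is
primitive. -/
theorem negJacobi_four_mul_sub_one {D : ℕ} (hD : 0 < D) : negJacobi D (4 * D - 1) = -1 := by
  have hodd : Odd (4 * D - 1) := ⟨2 * D - 1, by omega⟩
  have hJ4 := jacobiSym.at_four hodd
  have h1 : jacobiSym (4 * (D : ℤ)) (4 * D - 1) = 1 := by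
    rw [jacobiSym.mod_left' (a₂ := 1), jacobiSym.one_left]
    refine Int.ModEq.symm ((Int.modEq_iff_dvd).2 ⟨1, ?_⟩)
    push_cast [Nat.cast_sub (show 1 ≤ 4 * D by omega)]
    ring
  rw [jacobiSym.mul_left, hJ4, one_mul] at h1
  rw [negJacobi_of_odd hodd, jacobiSym.neg _ hodd, h1, ZMod.χ₄_nat_three_mod_four (by omega),
    mul_one]

theorem negJacobi_four_mul_sub {D n : ℕ} (hD : 0 < D) (hn : n ≤ 4 * D) :
    negJacobi D (4 * D - n) = - negJacobi D n := by
  have h : negJacobi D (4 * D - n) = negJacobi D (n * (4 * D - 1)) := by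
    apply negJacobi_congr
    change (4 * D - n) ≡ n * (4 * D - 1) [MOD 4 * D]
    rw [Nat.modEq_iff_dvd]
    refine ⟨n - 1, ?_⟩
    push_cast [Nat.cast_sub (show 1 ≤ 4 * D by omega), Nat.cast_sub hn]
    ring
  rw [h, negJacobi_mul, negJacobi_four_mul_sub_one hD, mul_neg_one]

theorem sum_range_negJacobi_period {D : ℕ} (hD : 0 < D) :
    ∑ n ∈ Finset.range (4 * D), negJacobi D n = 0 := by
  have h0 : negJacobi D 0 = 0 := negJacobi_of_even Even.zero
  have h4 : negJacobi D (4 * D) = 0 := negJacobi_of_even ⟨2 * D, by ring⟩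
  have h := Finset.sum_range_reflect (negJacobi D) (4 * D + 1)
  have h' : ∑ j ∈ Finset.range (4 * D + 1), negJacobi D (4 * D + 1 - 1 - j) =
      ∑ j ∈ Finset.range (4 * D + 1), - negJacobi D j := by
    refine Finset.sum_congr rfl fun j hj => ?_
    rw [Finset.mem_range] at hj
    exact negJacobi_four_mul_sub hD (by omega)
  rw [h', Finset.sum_neg_distrib, Finset.sum_range_succ, h4] at h
  omega

theorem sum_range_negJacobi_le {D : ℕ} (hD : 0 < D) (n : ℕ) :
    ∑ i ∈ Finset.range n, negJacobi D i ≤ 4 * D := by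
  induction n using Nat.strong_induction_on with
  | _ n ih =>
    rcases lt_or_ge n (4 * D) with h | h
    · calc _ ≤ ∑ i ∈ Finset.range n, (1 : ℤ) :=
            Finset.sum_le_sum fun i _ => (abs_le.1 (abs_negJacobi_le_one D i)).2
        _ ≤ _ := by simp; omega
    · obtain ⟨k, rfl⟩ := Nat.exists_eq_add_of_le h
      rw [Finset.sum_range_add, sum_range_negJacobi_period hD, zero_add]
      convert ih k (by omega) using 1
      refine Finset.sum_congr rfl fun i _ => negJacobi_congr (by simp)

/-- `negJacobi D` as a real arithmetic function. -/
noncomputable def negJacobiArith (D : ℕ) : ArithmeticFunction ℝ :=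
  ⟨fun n => (negJacobi D n : ℝ), by simp [negJacobi_of_even]⟩

theorem negJacobiArith_apply (D n : ℕ) : negJacobiArith D n = (negJacobi D n : ℝ) := rfl

theorem isMultiplicative_negJacobiArith (D : ℕ) : (negJacobiArith D).IsMultiplicative :=
  ⟨by simp [negJacobiArith_apply, negJacobi_one], fun {m n} _ => by
    simp [negJacobiArith_apply, negJacobi_mul]⟩

/-- The sum is multiplicative in `n`, and at a prime power it is a geometric sum with ratio `0`, `1`
or `-1`. -/
theorem sum_divisors_negJacobi_nonneg (D n : ℕ) :
    0 ≤ ∑ d ∈ n.divisors, (negJacobi D d : ℝ) := by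
  rcases eq_or_ne n 0 with rfl | hn
  · simp
  have hz : ∀ m, ((ArithmeticFunction.zeta : ArithmeticFunction ℝ) * negJacobiArith D) m =
      ∑ d ∈ m.divisors, (negJacobi D d : ℝ) := fun m => by
    rw [ArithmeticFunction.coe_zeta_mul_apply]; rfl
  rw [← hz]
  have hmul : ((ArithmeticFunction.zeta : ArithmeticFunction ℝ) *
      negJacobiArith D).IsMultiplicative :=
    ArithmeticFunction.isMultiplicative_zeta.natCast.mul (isMultiplicative_negJacobiArith D)
  rw [hmul.multiplicative_factorization _ hn]
  refine Finset.prod_nonneg fun p hp => ?_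
  beta_reduce
  rw [hz, Nat.sum_divisors_prime_pow (Nat.prime_of_mem_primeFactors hp)]
  simp only [negJacobi_pow, Int.cast_pow]
  rcases negJacobi_trichotomy D p with h | h | h
  · exact Finset.sum_nonneg fun i _ => by simp [h]
  · exact Finset.sum_nonneg fun i _ => by simp [h]
  · simp only [h, Int.cast_neg, Int.cast_one, neg_one_geom_sum]
    split_ifs <;> norm_num

/-! ### Reciprocal sums over split and non-inert numbers -/

/-- The arithmetic function `n ↦ 1 / n` weighted by `g`. -/
noncomputable def divId (g : ℕ → ℝ) : ArithmeticFunction ℝ := ⟨fun n => g n / n, by simp⟩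

theorem divId_apply (g : ℕ → ℝ) (n : ℕ) : divId g n = g n / n := rfl

theorem divId_mul_apply (g h : ℕ → ℝ) (n : ℕ) :
    (divId g * divId h) n = (∑ x ∈ n.divisorsAntidiagonal, g x.1 * h x.2) / n := by
  rw [ArithmeticFunction.mul_apply, Finset.sum_div]
  refine Finset.sum_congr rfl fun x hx => ?_
  rw [← (Nat.mem_divisorsAntidiagonal.1 hx).1, divId_apply, divId_apply]
  push_cast
  rw [div_mul_div_comm]

theorem sum_Ioc_divId_one (n : ℕ) :
    ∑ m ∈ Finset.Ioc 0 n, divId (fun _ => 1) m = (harmonic n : ℝ) := by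
  rw [harmonic_eq_sum_Icc]
  push_cast
  exact Finset.sum_congr rfl fun m _ => by simp [divId_apply]

theorem harmonic_cast_mono : Monotone fun n : ℕ => (harmonic n : ℝ) := by
  refine monotone_nat_of_le_succ fun n => ?_
  rw [harmonic_succ]
  push_cast
  have : (0 : ℝ) ≤ ((n : ℝ) + 1)⁻¹ := by positivity
  linarith

/-- Summing over the cofactor first leaves the character against the antitone weights `harmonic (N /
d) / d`; Abel's inequality then costs only the first weight, of size `log N`, times the bound on
character sums. -/
theorem sum_negJacobi_convolution_le {D : ℕ} (hD : 0 < D) (N : ℕ) :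
    ∑ n ∈ Finset.Ioc 0 N, (divId (fun n => (negJacobi D n : ℝ)) * divId fun _ => 1) n ≤
      4 * D * (1 + Real.log N) := by
  rw [ArithmeticFunction.sum_Ioc_mul_eq_sum_sum]
  simp only [sum_Ioc_divId_one]
  set c : ℕ → ℝ := fun i => (harmonic (N / (i + 1)) : ℝ) / (i + 1) with hc
  have hnn : ∀ n : ℕ, (0 : ℝ) ≤ harmonic n := fun n => by
    simpa using harmonic_cast_mono (Nat.zero_le n)
  have hanti : Antitone c := by
    intro i j hij
    have h1 : (harmonic (N / (j + 1)) : ℝ) ≤ harmonic (N / (i + 1)) :=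
      harmonic_cast_mono (Nat.div_le_div_left (by omega) (by omega))
    have h2 : (i : ℝ) ≤ j := by exact_mod_cast hij
    exact div_le_div₀ (hnn _) h1 (by positivity) (by linarith)
  have hg : ∀ n, ∑ i ∈ Finset.range n, (negJacobi D (i + 1) : ℝ) ≤ 4 * D := fun n => by
    have h := sum_range_negJacobi_le hD (n + 1)
    rw [Finset.sum_range_succ', negJacobi_of_even Even.zero, add_zero] at h
    exact_mod_cast h
  have h := sum_range_mul_le_of_antitone hanti (fun i => div_nonneg (hnn _) (by positivity)) hg N
  have h0 : c 0 ≤ 1 + Real.log N := by simpa [hc] using harmonic_le_one_add_log N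
  calc _ = ∑ i ∈ Finset.range N, c i * (negJacobi D (i + 1) : ℝ) := by
        rw [← Finset.Ico_add_one_add_one_eq_Ioc, Finset.sum_Ico_eq_sum_range]
        refine Finset.sum_congr (by simp) fun i _ => ?_
        simp only [hc, divId_apply]
        rw [show 0 + 1 + i = i + 1 by ring]
        push_cast
        ring
    _ ≤ _ := h
    _ ≤ _ := by gcongr

/-- The positive integers all of whose prime factors `p` satisfy `(-D | p) = 1`. -/
def splitNumbers (D : ℕ) : Set ℕ := {n | n ≠ 0 ∧ ∀ p, p.Prime → p ∣ n → negJacobi D p = 1}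

theorem negJacobi_eq_one_of_mem_splitNumbers {D n : ℕ} (hn : n ∈ splitNumbers D) :
    negJacobi D n = 1 := by
  induction n using Nat.recOnMul with
  | zero => exact absurd rfl hn.1
  | one => exact negJacobi_one D
  | prime p hp => exact hn.2 p hp dvd_rfl
  | mul a b iha ihb =>
    have h := mul_ne_zero_iff.1 hn.1
    rw [negJacobi_mul, iha ⟨h.1, fun p hp hd => hn.2 p hp (hd.mul_right b)⟩,
      ihb ⟨h.2, fun p hp hd => hn.2 p hp (hd.mul_left a)⟩, mul_one]

theorem mul_mem_splitNumbers {D a b : ℕ} (ha : a ∈ splitNumbers D) (hb : b ∈ splitNumbers D) :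
    a * b ∈ splitNumbers D :=
  ⟨mul_ne_zero ha.1 hb.1, fun p hp hd => ((hp.dvd_mul).1 hd).elim (ha.2 p hp) (hb.2 p hp)⟩

theorem mem_splitNumbers_of_dvd {D a b : ℕ} (hab : a ∣ b) (hb : b ∈ splitNumbers D) :
    a ∈ splitNumbers D :=
  ⟨fun h => hb.1 (by simpa [h] using hab), fun p hp hd => hb.2 p hp (hd.trans hab)⟩

-- With `i` the indicator of the split numbers, `i * i ≤ χ * 1` pointwise: on split `n` every
-- divisor has `χ = 1`, and elsewhere the left side vanishes while the right is nonnegative. The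
-- square of the sum lives on products up to `X ^ 2`, whence the factor `2` before the logarithm.
open scoped Classical in
theorem sq_sum_splitNumbers_le {D : ℕ} (hD : 0 < D) (X : ℕ) :
    (∑ s ∈ (Finset.Ioc 0 X).filter (· ∈ splitNumbers D), (1 : ℝ) / s) ^ 2 ≤
      4 * D * (1 + 2 * Real.log X) := by
  set i : ℕ → ℝ := fun n => if n ∈ splitNumbers D then 1 else 0 with hi
  have hi0 : ∀ n, 0 ≤ divId i n := fun n => by
    simp only [divId_apply, hi]; split_ifs <;> positivity
  have hs : ∑ s ∈ (Finset.Ioc 0 X).filter (· ∈ splitNumbers D), (1 : ℝ) / s =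
      ∑ s ∈ Finset.Ioc 0 X, divId i s := by
    rw [Finset.sum_filter]
    refine Finset.sum_congr rfl fun s _ => ?_
    simp only [divId_apply, hi]
    split_ifs <;> simp
  have h := sum_negJacobi_convolution_le hD (X ^ 2)
  rw [Nat.cast_pow, Real.log_pow] at h
  refine le_trans ?_ h
  calc (∑ s ∈ (Finset.Ioc 0 X).filter (· ∈ splitNumbers D), (1 : ℝ) / s) ^ 2
      = ∑ x ∈ Finset.Ioc 0 X ×ˢ Finset.Ioc 0 X, divId i x.1 * divId i x.2 := by
        rw [hs, sq, Finset.sum_mul_sum, Finset.sum_product]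
    _ ≤ ∑ n ∈ Finset.Ioc 0 (X ^ 2), (divId i * divId i) n := by
        rw [ArithmeticFunction.sum_Ioc_mul_eq_sum_prod_filter]
        refine Finset.sum_le_sum_of_subset_of_nonneg (fun x hx => ?_)
          fun x _ _ => mul_nonneg (hi0 _) (hi0 _)
        simp only [Finset.mem_product, Finset.mem_Ioc, Finset.mem_filter] at hx ⊢
        obtain ⟨⟨h1, h2⟩, h3, h4⟩ := hx
        have := Nat.mul_le_mul h2 h4
        have h5 : X ≤ X ^ 2 := Nat.le_self_pow (by norm_num) X
        exact ⟨⟨⟨h1, by omega⟩, h3, by omega⟩, by rwa [sq]⟩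
    _ ≤ _ := by
        refine Finset.sum_le_sum fun n hn => ?_
        rw [divId_mul_apply, divId_mul_apply]
        refine div_le_div_of_nonneg_right ?_ (Nat.cast_nonneg n)
        by_cases hU : n ∈ splitNumbers D
        · refine Finset.sum_le_sum fun x hx => ?_
          have hx' := (Nat.mem_divisorsAntidiagonal.1 hx).1
          have h1 : x.1 ∈ splitNumbers D := mem_splitNumbers_of_dvd ⟨_, hx'.symm⟩ hU
          simp only [hi, h1, if_true, negJacobi_eq_one_of_mem_splitNumbers h1]
          split_ifs <;> norm_num
        · have h1 : ∑ x ∈ n.divisorsAntidiagonal, i x.1 * i x.2 = 0 := by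
            refine Finset.sum_eq_zero fun x hx => ?_
            have hx' := (Nat.mem_divisorsAntidiagonal.1 hx).1
            simp only [hi]
            split_ifs with ha hb
            · exact absurd (hx' ▸ mul_mem_splitNumbers ha hb) hU
            all_goals simp
          rw [h1]
          simp only [mul_one]
          rw [Nat.sum_divisorsAntidiagonal (fun d _ => (negJacobi D d : ℝ))]
          exact sum_divisors_negJacobi_nonneg D n

theorem sum_le_sum_of_injOn_of_le {α β : Type*} [DecidableEq β] {s : Finset α} {t : Finset β}
    {g : α → ℝ} {h : β → ℝ} (e : α → β) (he : ∀ a ∈ s, e a ∈ t) (hinj : Set.InjOn e s)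
    (hgh : ∀ a ∈ s, g a ≤ h (e a)) (h0 : ∀ b ∈ t, 0 ≤ h b) :
    ∑ a ∈ s, g a ≤ ∑ b ∈ t, h b :=
  calc _ ≤ ∑ a ∈ s, h (e a) := Finset.sum_le_sum hgh
    _ = ∑ b ∈ s.image e, h b := (Finset.sum_image hinj).symm
    _ ≤ _ := Finset.sum_le_sum_of_subset_of_nonneg (Finset.image_subset_iff.2 he)
        fun b hb _ => h0 b hb

/-- The squarefree positive integers without prime factors `p` such that `(-D | p) = -1`. -/
def squarefreeNoninert (D : ℕ) : Set ℕ :=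
  {n | Squarefree n ∧ ∀ p, p.Prime → p ∣ n → negJacobi D p ≠ -1}

theorem squarefreeNoninert_of_dvd {D a b : ℕ} (hab : a ∣ b) (hb : b ∈ squarefreeNoninert D) :
    a ∈ squarefreeNoninert D :=
  ⟨hb.1.squarefree_of_dvd hab, fun p hp hd => hb.2 p hp (hd.trans hab)⟩

theorem dvd_two_mul_of_negJacobi_eq_zero {D p : ℕ} (hp : p.Prime) (h : negJacobi D p = 0) :
    p ∣ 2 * D := by
  rcases hp.eq_two_or_odd' with rfl | hodd
  · exact dvd_mul_right 2 D
  rw [negJacobi_of_odd hodd, jacobiSym.eq_zero_iff] at h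
  have h2 : ¬ Nat.Coprime p D := fun hc => h.2 (by
    rw [Int.gcd_eq_natAbs, Int.natAbs_neg]; exact hc.symm)
  exact (((Nat.Prime.dvd_iff_not_coprime hp).2 h2)).mul_left 2

theorem div_gcd_mem_splitNumbers {D s : ℕ} (hs : s ∈ squarefreeNoninert D) :
    s / s.gcd (2 * D) ∈ splitNumbers D := by
  have hmul : s.gcd (2 * D) * (s / s.gcd (2 * D)) = s := Nat.mul_div_cancel' (Nat.gcd_dvd_left _ _)
  have hs0 : s ≠ 0 := hs.1.ne_zero
  refine ⟨fun h => hs0 (by rw [← hmul, h, mul_zero]), fun p hp hd => ?_⟩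
  have hps : p ∣ s := hmul ▸ hd.mul_left _
  rcases negJacobi_trichotomy D p with h | h | h
  · have hpg : p ∣ s.gcd (2 * D) := Nat.dvd_gcd hps (dvd_two_mul_of_negJacobi_eq_zero hp h)
    have hpp : p * p ∣ s := hmul ▸ mul_dvd_mul hpg hd
    exact absurd (hs.1 p hpp) (Nat.prime_iff.1 hp).not_isUnit
  · exact h
  · exact absurd h (hs.2 p hp hps)

open scoped Classical in
/-- The reciprocal sum over `squarefreeNoninert D` up to `X`. -/
noncomputable def noninertRecip (D X : ℕ) : ℝ :=
  ∑ s ∈ (Finset.Ioc 0 X).filter (· ∈ squarefreeNoninert D), (1 : ℝ) / s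

theorem noninertRecip_mono (D : ℕ) : Monotone (noninertRecip D) := by
  classical
  exact fun _ _ h => Finset.sum_le_sum_of_subset_of_nonneg
    (Finset.filter_subset_filter _ (Finset.Ioc_subset_Ioc_right h)) fun _ _ _ => by positivity

theorem noninertRecip_nonneg (D X : ℕ) : 0 ≤ noninertRecip D X :=
  Finset.sum_nonneg fun _ _ => by positivity

/-- Only primes dividing `2D` have character value `0`, so dividing a squarefree `s` by `s.gcd (2 *
D)` leaves a split number. There are at most `2D` possible gcds. -/
theorem noninertRecip_le {D : ℕ} (hD : 0 < D) (X : ℕ) :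
    noninertRecip D X ≤ 2 * D * Real.sqrt (4 * D * (1 + 2 * Real.log X)) := by
  classical
  have h := Real.le_sqrt_of_sq_le (sq_sum_splitNumbers_le hD X)
  refine le_trans ?_ (mul_le_mul_of_nonneg_left h (by positivity))
  have h2 : ∑ x ∈ Finset.Ioc 0 (2 * D) ×ˢ (Finset.Ioc 0 X).filter (· ∈ splitNumbers D),
      (1 : ℝ) / x.2 = 2 * D * ∑ s ∈ (Finset.Ioc 0 X).filter (· ∈ splitNumbers D), (1 : ℝ) / s := by
    rw [Finset.sum_product]
    simp
  rw [← h2]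
  have hdecomp : ∀ s : ℕ, s.gcd (2 * D) * (s / s.gcd (2 * D)) = s := fun s =>
    Nat.mul_div_cancel' (Nat.gcd_dvd_left _ _)
  refine sum_le_sum_of_injOn_of_le (fun s => (s.gcd (2 * D), s / s.gcd (2 * D))) ?_ ?_ ?_
    fun _ _ => by positivity
  · intro s hs
    simp only [Finset.mem_filter, Finset.mem_Ioc, Finset.mem_product] at hs ⊢
    have hm := div_gcd_mem_splitNumbers hs.2
    exact ⟨⟨Nat.gcd_pos_of_pos_left _ hs.1.1, Nat.gcd_le_right _ (by omega)⟩,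
      ⟨Nat.pos_of_ne_zero hm.1, (Nat.div_le_self _ _).trans hs.1.2⟩, hm⟩
  · intro a _ b _ hab
    simp only [Prod.mk.injEq] at hab
    exact (hdecomp a).symm.trans ((congrArg₂ (· * ·) hab.1 hab.2).trans (hdecomp b))
  · intro s hs
    simp only [Finset.mem_filter, Finset.mem_Ioc] at hs
    have hm := div_gcd_mem_splitNumbers hs.2
    refine one_div_le_one_div_of_le (by exact_mod_cast Nat.pos_of_ne_zero hm.1) ?_
    exact_mod_cast Nat.div_le_self _ _

/-! ### Counting the values of `u ^ 2 + D w ^ 2` -/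

-- Expand `log s = ∑ log p` over `p ∣ s` and regroup by `m = s / p`: the primes up to `Y / m`
-- contribute at most `θ(Y / m) ≤ log 4 * Y / m`.
open scoped Classical in
theorem sum_log_squarefreeNoninert_le (D Y : ℕ) :
    ∑ s ∈ (Finset.Ioc 0 Y).filter (· ∈ squarefreeNoninert D), Real.log s ≤
      Real.log 4 * Y * noninertRecip D Y := by
  calc ∑ s ∈ (Finset.Ioc 0 Y).filter (· ∈ squarefreeNoninert D), Real.log s
      = ∑ s ∈ (Finset.Ioc 0 Y).filter (· ∈ squarefreeNoninert D),
          ∑ p ∈ s.primeFactors, Real.log p := by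
        refine Finset.sum_congr rfl fun s hs => ?_
        rw [Finset.mem_filter] at hs
        conv_lhs => rw [← Nat.prod_primeFactors_of_squarefree hs.2.1]
        rw [Nat.cast_prod, Real.log_prod]
        intro p hp
        exact_mod_cast (Nat.prime_of_mem_primeFactors hp).ne_zero
    _ ≤ ∑ m ∈ (Finset.Ioc 0 Y).filter (· ∈ squarefreeNoninert D),
          ∑ p ∈ (Finset.Ioc 0 ⌊(Y : ℝ) / m⌋₊).filter Nat.Prime, Real.log p := by
        rw [Finset.sum_sigma', Finset.sum_sigma']
        refine sum_le_sum_of_injOn_of_le (fun x => ⟨x.1 / x.2, x.2⟩) ?_ ?_ (fun _ _ => le_rfl) ?_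
        · rintro ⟨s, p⟩ hx
          simp only [Finset.mem_sigma, Finset.mem_filter, Finset.mem_Ioc,
            Nat.mem_primeFactors] at hx ⊢
          obtain ⟨⟨⟨hs0, hsY⟩, hs⟩, hp, hps, -⟩ := hx
          have hpos : 0 < s / p := Nat.div_pos (Nat.le_of_dvd hs0 hps) hp.pos
          refine ⟨⟨⟨hpos, (Nat.div_le_self _ _).trans hsY⟩,
            squarefreeNoninert_of_dvd (Nat.div_dvd_of_dvd hps) hs⟩, ⟨hp.pos, ?_⟩, hp⟩
          rw [Nat.floor_div_natCast, Nat.floor_natCast, Nat.le_div_iff_mul_le hpos,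
            Nat.mul_div_cancel' hps]
          exact hsY
        · rintro ⟨s, p⟩ hx ⟨s', p'⟩ hx' h
          simp only [Finset.coe_sigma, Set.mem_sigma_iff, Finset.mem_coe, Nat.mem_primeFactors]
            at hx hx'
          simp only [Sigma.mk.injEq, heq_eq_eq] at h ⊢
          obtain ⟨h1, rfl⟩ := h
          refine ⟨?_, rfl⟩
          rw [← Nat.div_mul_cancel hx.2.2.1, h1, Nat.div_mul_cancel hx'.2.2.1]
        · rintro ⟨m, p⟩ hx
          simp only [Finset.mem_sigma, Finset.mem_filter, Finset.mem_Ioc] at hx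
          exact Real.log_nonneg (by exact_mod_cast hx.2.1.1)
    _ ≤ ∑ m ∈ (Finset.Ioc 0 Y).filter (· ∈ squarefreeNoninert D), Real.log 4 * (Y / m) :=
        Finset.sum_le_sum fun m _ => Chebyshev.theta_le_log4_mul_x (by positivity)
    _ = _ := by
        rw [noninertRecip, Finset.mul_sum]
        exact Finset.sum_congr rfl fun m _ => by ring

/-- After removing `gcd(u, w)`, an inert prime dividing `u ^ 2 + D w ^ 2` would divide both coprime
variables. -/
theorem exists_sq_mul_squarefreeNoninert {D n : ℕ} (hn : 0 < n) {u w : ℤ}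
    (h : (n : ℤ) = u ^ 2 + D * w ^ 2) :
    ∃ t s : ℕ, 0 < t ∧ s ∈ squarefreeNoninert D ∧ t ^ 2 * s = n := by
  have hg : 0 < Int.gcd u w := by
    rw [Int.gcd_pos_iff]
    by_contra! hc
    rw [hc.1, hc.2] at h
    simp at h
    omega
  obtain ⟨u', w', hco, hu, hw⟩ := Int.exists_gcd_one hg
  set g := Int.gcd u w
  have hdvd : ((g ^ 2 : ℕ) : ℤ) ∣ (n : ℤ) := ⟨u' ^ 2 + D * w' ^ 2, by
    rw [h, hu, hw]; push_cast; ring⟩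
  obtain ⟨m, rfl⟩ := Int.natCast_dvd_natCast.1 hdvd
  have hm : (m : ℤ) = u' ^ 2 + D * w' ^ 2 := by
    have hg2 : ((g : ℤ) ^ 2) ≠ 0 := by positivity
    apply mul_left_cancel₀ hg2
    have h' := h
    rw [hu, hw] at h'
    push_cast at h'
    linarith
  obtain ⟨s, b, hs0, hb0, hsb, hsq⟩ := Nat.sq_mul_squarefree_of_pos (Nat.pos_of_mul_pos_left hn)
  refine ⟨g * b, s, Nat.mul_pos hg hb0, ⟨hsq, fun p hp hps hneg => ?_⟩, by rw [← hsb]; ring⟩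
  have : Fact p.Prime := ⟨hp⟩
  have hodd : Odd p := by
    by_contra hc
    rw [negJacobi_of_even (Nat.not_odd_iff_even.1 hc)] at hneg
    norm_num at hneg
  rw [negJacobi_of_odd hodd, ← jacobiSym.legendreSym.to_jacobiSym] at hneg
  have hpm : (p : ℤ) ∣ u' ^ 2 - (-(D : ℤ)) * w' ^ 2 := by
    have : (p : ℤ) ∣ m := Int.natCast_dvd_natCast.2 (hsb ▸ hps.mul_left _)
    rw [hm] at this
    convert this using 1
    ring
  obtain ⟨h1, h2⟩ := legendreSym.prime_dvd_of_eq_neg_one hneg hpm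
  have h3 := Int.dvd_coe_gcd h1 h2
  rw [hco] at h3
  exact hp.one_lt.ne' (by exact_mod_cast Int.eq_one_of_dvd_one (by positivity) h3)

theorem log_le_two_mul_sqrt {x : ℝ} (hx : 0 < x) : Real.log x ≤ 2 * Real.sqrt x := by
  have h := Real.log_le_sub_one_of_pos (Real.sqrt_pos.2 hx)
  rw [Real.log_sqrt hx.le] at h
  linarith

theorem summable_log_div_sq : Summable fun t : ℕ => 2 * Real.log t / (t : ℝ) ^ 2 := by
  refine Summable.of_nonneg_of_le (fun t => div_nonneg (by positivity) (by positivity))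
    (fun t => ?_) ((Real.summable_nat_rpow_inv (p := 3 / 2)).2 (by norm_num) |>.mul_left 4)
  rcases Nat.eq_zero_or_pos t with rfl | ht
  · simp
  have ht' : (0 : ℝ) < t := by exact_mod_cast ht
  have h := log_le_two_mul_sqrt ht'
  rw [div_le_iff₀ (by positivity)]
  have h2 : ((t : ℝ) ^ (3 / 2 : ℝ))⁻¹ * (t : ℝ) ^ 2 = Real.sqrt t := by
    rw [← Real.rpow_neg ht'.le, ← Real.rpow_natCast (t : ℝ) 2, ← Real.rpow_add ht',
      Real.sqrt_eq_rpow]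
    norm_num
  rw [mul_assoc, h2]
  linarith

open scoped Classical in
theorem card_mul_log_le (D X : ℕ) (t : ℕ) (ht : 0 < t) (hX : 0 < X) :
    (((Finset.Ioc 0 (X / t ^ 2)).filter (· ∈ squarefreeNoninert D)).card : ℝ) * Real.log X ≤
      X * ((1 + Real.log 4) * noninertRecip D X * (1 / (t : ℝ) ^ 2) +
        2 * Real.log t / (t : ℝ) ^ 2) := by
  have ht' : (0 : ℝ) < t := by exact_mod_cast ht
  have hX' : (0 : ℝ) < X := by exact_mod_cast hX
  set Y := X / t ^ 2
  set A := (Finset.Ioc 0 Y).filter (· ∈ squarefreeNoninert D) with hA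
  have hY : (Y : ℝ) ≤ X / (t : ℝ) ^ 2 := by
    have := @Nat.cast_div_le ℝ _ _ _ X (t ^ 2)
    simpa using this
  have hcard : (A.card : ℝ) ≤ Y := by
    have h : A.card ≤ (Finset.Ioc 0 Y).card := Finset.card_filter_le _ _
    rw [Nat.card_Ioc, Nat.sub_zero] at h
    exact_mod_cast h
  have hYX : noninertRecip D Y ≤ noninertRecip D X := noninertRecip_mono D (Nat.div_le_self _ _)
  -- Split `log X = log (X / (t ^ 2 s)) + log s + 2 log t` and use `log z ≤ z` on the first term, so
  -- that it sums to a reciprocal sum.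
  have hlog : ∀ s ∈ A, Real.log X ≤ X / (t : ℝ) ^ 2 * (1 / s) + Real.log s + 2 * Real.log t := by
    intro s hs
    simp only [hA, Finset.mem_filter, Finset.mem_Ioc] at hs
    have hs' : (0 : ℝ) < s := by exact_mod_cast hs.1.1
    have h1 := Real.log_le_sub_one_of_pos (x := X / (t : ℝ) ^ 2 * (1 / s)) (by positivity)
    have h2 : Real.log (X / (t : ℝ) ^ 2 * (1 / s)) = Real.log X - 2 * Real.log t - Real.log s := by
      rw [Real.log_mul (by positivity) (by positivity), Real.log_div (by positivity)
        (by positivity), Real.log_pow, one_div, Real.log_inv]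
      push_cast
      ring
    linarith
  calc (A.card : ℝ) * Real.log X = ∑ s ∈ A, Real.log X := by simp
    _ ≤ ∑ s ∈ A, (X / (t : ℝ) ^ 2 * (1 / s) + Real.log s + 2 * Real.log t) :=
        Finset.sum_le_sum hlog
    _ = X / (t : ℝ) ^ 2 * noninertRecip D Y + ∑ s ∈ A, Real.log s + A.card * (2 * Real.log t) := by
        rw [Finset.sum_add_distrib, Finset.sum_add_distrib, ← Finset.mul_sum]
        simp [noninertRecip, hA]
    _ ≤ X / (t : ℝ) ^ 2 * noninertRecip D X +
          Real.log 4 * (X / (t : ℝ) ^ 2) * noninertRecip D X +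
          X / (t : ℝ) ^ 2 * (2 * Real.log t) := by
        have h0 := noninertRecip_nonneg D Y
        have h4 : 0 ≤ Real.log 4 := Real.log_nonneg (by norm_num)
        have ht1 : 0 ≤ Real.log t := Real.log_natCast_nonneg t
        have h1 : ∑ s ∈ A, Real.log s ≤ Real.log 4 * (X / (t : ℝ) ^ 2) * noninertRecip D X :=
          (sum_log_squarefreeNoninert_le D Y).trans (by gcongr)
        have h2 := hcard.trans hY
        gcongr
    _ = _ := by ring

open scoped Classical in
theorem exists_card_rep_le {D : ℕ} (hD : 0 < D) :
    ∃ K : ℝ, 0 < K ∧ ∀ X : ℕ, 3 ≤ X →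
      (((Finset.Ioc 0 X).filter fun n : ℕ => ∃ u w : ℤ, (n : ℤ) = u ^ 2 + D * w ^ 2).card : ℝ) ≤
        K * (X / Real.sqrt (Real.log X)) := by
  set C₁ := ∑' t : ℕ, 1 / (t : ℝ) ^ 2
  set C₂ := ∑' t : ℕ, 2 * Real.log t / (t : ℝ) ^ 2
  have hC₁ : 0 ≤ C₁ := tsum_nonneg fun t => by positivity
  have hC₂ : 0 ≤ C₂ := tsum_nonneg fun t => by positivity
  have hl4 : 0 ≤ Real.log 4 := Real.log_nonneg (by norm_num)
  refine ⟨(1 + Real.log 4) * (2 * D * Real.sqrt (12 * D)) * C₁ + C₂ + 1, by positivity,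
    fun X hX => ?_⟩
  set R := (Finset.Ioc 0 X).filter fun n : ℕ => ∃ u w : ℤ, (n : ℤ) = u ^ 2 + D * w ^ 2 with hR
  have hX0 : (0 : ℝ) < X := by positivity
  have hlog1 : 1 ≤ Real.log X := by
    rw [Real.le_log_iff_exp_le hX0]
    have h3 : (3 : ℝ) ≤ X := by exact_mod_cast hX
    linarith [Real.exp_one_lt_d9]
  have hcard : R.card ≤ ∑ t ∈ Finset.Ioc 0 X,
      ((Finset.Ioc 0 (X / t ^ 2)).filter (· ∈ squarefreeNoninert D)).card := by
    rw [← Finset.card_sigma]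
    refine le_trans (Finset.card_le_card fun n hn => ?_)
      (Finset.card_image_le (f := fun x : (_ : ℕ) × ℕ => x.1 ^ 2 * x.2))
    simp only [hR, Finset.mem_filter, Finset.mem_Ioc] at hn
    obtain ⟨⟨hn0, hnX⟩, u, w, huw⟩ := hn
    obtain ⟨t, s, ht, hs, hts⟩ := exists_sq_mul_squarefreeNoninert hn0 huw
    have hs0 : 0 < s := Nat.pos_of_ne_zero hs.1.ne_zero
    have ht2 : 0 < t ^ 2 := by positivity
    refine Finset.mem_image.2 ⟨⟨t, s⟩, ?_, hts⟩
    simp only [Finset.mem_sigma, Finset.mem_filter, Finset.mem_Ioc]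
    refine ⟨⟨ht, ?_⟩, ⟨hs0, ?_⟩, hs⟩
    · calc t ≤ t ^ 2 := Nat.le_self_pow (by norm_num) t
        _ ≤ t ^ 2 * s := Nat.le_mul_of_pos_right _ hs0
        _ ≤ X := by omega
    · rw [Nat.le_div_iff_mul_le ht2, mul_comm, hts]
      exact hnX
  have hmain : (R.card : ℝ) * Real.log X ≤
      X * ((1 + Real.log 4) * noninertRecip D X * C₁ + C₂) := by
    calc (R.card : ℝ) * Real.log X ≤ (∑ t ∈ Finset.Ioc 0 X,
          ((Finset.Ioc 0 (X / t ^ 2)).filter (· ∈ squarefreeNoninert D)).card : ℕ) *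
            Real.log X := by gcongr
      _ = ∑ t ∈ Finset.Ioc 0 X,
          (((Finset.Ioc 0 (X / t ^ 2)).filter (· ∈ squarefreeNoninert D)).card : ℝ) *
            Real.log X := by
          push_cast
          rw [Finset.sum_mul]
      _ ≤ ∑ t ∈ Finset.Ioc 0 X, X * ((1 + Real.log 4) * noninertRecip D X * (1 / (t : ℝ) ^ 2) +
            2 * Real.log t / (t : ℝ) ^ 2) :=
          Finset.sum_le_sum fun t ht =>
            card_mul_log_le D X t (Finset.mem_Ioc.1 ht).1 (by omega)
      _ = X * ((1 + Real.log 4) * noninertRecip D X * ∑ t ∈ Finset.Ioc 0 X, 1 / (t : ℝ) ^ 2 +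
            ∑ t ∈ Finset.Ioc 0 X, 2 * Real.log t / (t : ℝ) ^ 2) := by
          rw [← Finset.mul_sum, Finset.sum_add_distrib, ← Finset.mul_sum]
      _ ≤ _ := by
          have h0 := noninertRecip_nonneg D X
          have h1 : ∑ t ∈ Finset.Ioc 0 X, 1 / (t : ℝ) ^ 2 ≤ C₁ :=
            (Real.summable_one_div_nat_pow.2 (by norm_num)).sum_le_tsum _
              fun _ _ => by positivity
          have h2 : ∑ t ∈ Finset.Ioc 0 X, 2 * Real.log t / (t : ℝ) ^ 2 ≤ C₂ :=
            summable_log_div_sq.sum_le_tsum _ fun _ _ => by positivity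
          gcongr
  -- Since `1 ≤ log X`, `4D (1 + 2 log X) ≤ 12 D log X`.
  have hL : noninertRecip D X ≤ 2 * D * Real.sqrt (12 * D) * Real.sqrt (Real.log X) := by
    refine (noninertRecip_le hD X).trans ?_
    rw [mul_assoc (2 * (D : ℝ)) (Real.sqrt (12 * D)), ← Real.sqrt_mul (by positivity)]
    refine mul_le_mul_of_nonneg_left (Real.sqrt_le_sqrt ?_) (by positivity)
    have : (0 : ℝ) < D := by exact_mod_cast hD
    nlinarith
  have hs1 : 1 ≤ Real.sqrt (Real.log X) := Real.one_le_sqrt.2 hlog1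
  have hss : Real.sqrt (Real.log X) * Real.sqrt (Real.log X) = Real.log X :=
    Real.mul_self_sqrt (by linarith)
  set q := Real.sqrt (Real.log X)
  rw [← mul_div_assoc, le_div_iff₀ (by linarith)]
  refine le_of_mul_le_mul_right (a := q) ?_ (by linarith)
  rw [mul_assoc, hss]
  refine hmain.trans ?_
  calc (X : ℝ) * ((1 + Real.log 4) * noninertRecip D X * C₁ + C₂)
      ≤ X * ((1 + Real.log 4) * (2 * D * Real.sqrt (12 * D) * q) * C₁ + C₂ * q + 1 * q) := by
        have : C₂ ≤ C₂ * q := le_mul_of_one_le_right hC₂ hs1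
        have h2 : (1 + Real.log 4) * noninertRecip D X * C₁ ≤
          (1 + Real.log 4) * (2 * D * Real.sqrt (12 * D) * q) * C₁ := by gcongr
        refine mul_le_mul_of_nonneg_left ?_ hX0.le
        linarith
    _ = _ := by ring

/-! ### Integer polynomials bounded below -/

theorem coeff_nonneg_of_bddBelow {p S : ℤ} {k : ℕ} {r : ℤ → ℤ} (hr : ∀ y, 1 ≤ y → r y ≤ S * y ^ k)
    (h : ∀ y, 1 ≤ y → 0 ≤ p * y ^ (k + 1) + r y) : 0 ≤ p := by
  by_contra! hp
  -- At this `y > S`, a leading coefficient `p ≤ -1` already outweighs the remainder.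
  have hy : 1 ≤ max S 0 + 1 := by omega
  have h1 := hr _ hy
  have h2 := h _ hy
  set y := max S 0 + 1
  have hS : S ≤ y - 1 := by omega
  have hyk : 0 < y ^ k := by positivity
  rw [pow_succ] at h2
  nlinarith [mul_le_mul_of_nonneg_right hS hyk.le, mul_pos hyk (show 0 < y by omega)]

theorem mul_pow_le_abs_mul_pow {p y : ℤ} {i j : ℕ} (hy : 1 ≤ y) (hij : i ≤ j) :
    p * y ^ i ≤ |p| * y ^ j :=
  (mul_le_mul_of_nonneg_right (le_abs_self p) (by positivity)).trans
    (mul_le_mul_of_nonneg_left (pow_le_pow_right₀ hy hij) (abs_nonneg p))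

theorem linear_coeff_nonneg {p q : ℤ} (h : ∀ y : ℤ, 1 ≤ y → 0 ≤ p * y + q) : 0 ≤ p :=
  coeff_nonneg_of_bddBelow (S := q) (k := 0) (r := fun _ => q) (fun y _ => by simp)
    fun y hy => by simpa using h y hy

theorem linear_coeff_eq_zero {p q : ℤ} (h : ∀ y : ℤ, 0 ≤ p * y + q) : p = 0 := by
  have h1 := linear_coeff_nonneg fun y _ => h y
  have h2 := linear_coeff_nonneg (p := -p) (q := q) fun y _ => by linarith [h (-y)]
  omega

theorem quadratic_coeff_nonneg {p₂ p₁ p₀ : ℤ} (h : ∀ y : ℤ, 0 ≤ p₂ * y ^ 2 + p₁ * y + p₀) :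
    0 ≤ p₂ :=
  coeff_nonneg_of_bddBelow (S := |p₁| + |p₀|) (k := 1) (r := fun y => p₁ * y + p₀)
    (fun y hy => by
      have h1 := mul_pow_le_abs_mul_pow (p := p₁) hy (le_refl 1)
      have h0 := mul_pow_le_abs_mul_pow (p := p₀) hy (Nat.zero_le 1)
      rw [pow_zero] at h0
      linarith)
    fun y _ => by linear_combination h y

theorem cubic_coeff_nonneg {p₃ p₂ p₁ p₀ : ℤ}
    (h : ∀ y : ℤ, 1 ≤ y → 0 ≤ p₃ * y ^ 3 + p₂ * y ^ 2 + p₁ * y + p₀) : 0 ≤ p₃ :=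
  coeff_nonneg_of_bddBelow (S := |p₂| + |p₁| + |p₀|) (k := 2)
    (r := fun y => p₂ * y ^ 2 + p₁ * y + p₀)
    (fun y hy => by
      have h2 := mul_pow_le_abs_mul_pow (p := p₂) hy (le_refl 2)
      have h1 := mul_pow_le_abs_mul_pow (p := p₁) hy (show 1 ≤ 2 by norm_num)
      have h0 := mul_pow_le_abs_mul_pow (p := p₀) hy (Nat.zero_le 2)
      rw [pow_zero] at h0
      rw [pow_one] at h1
      linarith)
    fun y hy => by linear_combination h y hy

theorem cubic_coeff_eq_zero {p₃ p₂ p₁ p₀ : ℤ}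
    (h : ∀ y : ℤ, 0 ≤ p₃ * y ^ 3 + p₂ * y ^ 2 + p₁ * y + p₀) : p₃ = 0 := by
  have h1 := cubic_coeff_nonneg fun y _ => h y
  have h2 := cubic_coeff_nonneg (p₃ := -p₃) (p₂ := p₂) (p₁ := -p₁) (p₀ := p₀)
    fun y _ => by linarith [h (-y)]
  omega

theorem quartic_coeff_nonneg {p₄ p₃ p₂ p₁ p₀ : ℤ}
    (h : ∀ y : ℤ, 0 ≤ p₄ * y ^ 4 + p₃ * y ^ 3 + p₂ * y ^ 2 + p₁ * y + p₀) : 0 ≤ p₄ :=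
  coeff_nonneg_of_bddBelow (S := |p₃| + |p₂| + |p₁| + |p₀|) (k := 3)
    (r := fun y => p₃ * y ^ 3 + p₂ * y ^ 2 + p₁ * y + p₀)
    (fun y hy => by
      have h3 := mul_pow_le_abs_mul_pow (p := p₃) hy (le_refl 3)
      have h2 := mul_pow_le_abs_mul_pow (p := p₂) hy (show 2 ≤ 3 by norm_num)
      have h1 := mul_pow_le_abs_mul_pow (p := p₁) hy (show 1 ≤ 3 by norm_num)
      have h0 := mul_pow_le_abs_mul_pow (p := p₀) hy (Nat.zero_le 3)
      rw [pow_zero] at h0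
      rw [pow_one] at h1
      linarith)
    fun y _ => by linear_combination h y

theorem abs_le_mul_of_quartic_le {p₄ p₃ p₂ p₁ p₀ T r x : ℤ} (hp₄ : 0 < p₄) (hT : 0 ≤ T)
    (hr : 1 ≤ r)
    (h : p₄ * x ^ 4 + p₃ * x ^ 3 + p₂ * x ^ 2 + p₁ * x + p₀ ≤ T * r ^ 4) :
    |x| ≤ (T + |p₃| + |p₂| + |p₁| + |p₀| + 1) * r := by
  by_contra! hx
  set S := |p₃| + |p₂| + |p₁| + |p₀| with hS
  have hS0 : 0 ≤ S := by positivity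
  set t := |x| with ht
  have hrt : r ≤ t := by nlinarith
  have ht1 : 1 ≤ t := hr.trans hrt
  have hlow : ∀ (p : ℤ) (i : ℕ), i ≤ 3 → -(|p| * t ^ 3) ≤ p * x ^ i := fun p i hi => by
    have h1 : |p * x ^ i| ≤ |p| * t ^ 3 := by
      rw [abs_mul, abs_pow]
      exact mul_le_mul_of_nonneg_left (pow_le_pow_right₀ ht1 hi) (abs_nonneg p)
    exact (abs_le.1 h1).1
  have h3 := hlow p₃ 3 le_rfl
  have h2 := hlow p₂ 2 (by norm_num)
  have h1 := hlow p₁ 1 (by norm_num)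
  have h0 := hlow p₀ 0 (by norm_num)
  rw [pow_zero] at h0
  rw [pow_one] at h1
  have hx4 : x ^ 4 = t * t ^ 3 := by
    rw [← pow_succ', ht, Even.pow_abs (by decide)]
  have ht3 : 0 < t ^ 3 := by positivity
  have h4 : t * t ^ 3 ≤ p₄ * x ^ 4 := by
    rw [hx4]
    exact le_mul_of_one_le_left (by positivity) hp₄
  have hr4 : r ^ 4 ≤ r * t ^ 3 := by
    rw [pow_succ']
    exact mul_le_mul_of_nonneg_left (pow_le_pow_left₀ (by omega) hrt 3) (by omega)
  have h5 : T * r ^ 4 ≤ T * (r * t ^ 3) := mul_le_mul_of_nonneg_left hr4 hT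
  have h6 : (T + |p₃| + |p₂| + |p₁| + |p₀| + 1) * r * t ^ 3 < t * t ^ 3 :=
    mul_lt_mul_of_pos_right hx ht3
  have h7 : S * t ^ 3 ≤ S * (r * t ^ 3) :=
    mul_le_mul_of_nonneg_left (le_mul_of_one_le_left ht3.le hr) hS0
  have h8 : 0 ≤ r * t ^ 3 := by positivity
  have h9 : (T + |p₃| + |p₂| + |p₁| + |p₀| + 1) * r * t ^ 3 =
      T * (r * t ^ 3) + S * (r * t ^ 3) + r * t ^ 3 := by rw [hS]; ring
  have h10 : S * t ^ 3 = |p₃| * t ^ 3 + |p₂| * t ^ 3 + |p₁| * t ^ 3 + |p₀| * t ^ 3 := by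
    rw [hS]; ring
  linarith

/-! ### Counting in a box and along an affine image -/

/-- A finite set covered by a box of side lengths `≪ N ^ (1 / 4)` and `≪ N ^ (1 / 2)` has
`≪ N / √(log N)` elements. -/
theorem card_le_of_subset_image_box {K : ℕ} {N : ℕ} (hN : 2 ≤ N) (φ : ℤ × ℤ → ℤ) (A : Finset ℤ)
    (hA : ∀ n ∈ A, ∃ x y : ℤ, φ (x, y) = n ∧
      |x| ≤ K * (⌈Real.sqrt (Real.sqrt N)⌉₊ : ℤ) ∧
      |y| ≤ K * (⌈Real.sqrt (Real.sqrt N)⌉₊ : ℤ) ^ 2) :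
    (A.card : ℝ) ≤ 16 * (2 * K + 1) ^ 2 * (N / Real.sqrt (Real.log N)) := by
  set s := Real.sqrt (Real.sqrt N) with hs
  set r := ⌈s⌉₊ with hr
  have hN1 : (2 : ℝ) ≤ N := by exact_mod_cast hN
  have hs2 : s ^ 2 = Real.sqrt N := Real.sq_sqrt (Real.sqrt_nonneg _)
  have hs4 : s ^ 4 = N := by
    rw [show s ^ 4 = (s ^ 2) ^ 2 by ring, hs2, Real.sq_sqrt (by positivity)]
  have hs1 : 1 ≤ s := Real.one_le_sqrt.2 (Real.one_le_sqrt.2 (by linarith))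
  have hr1 : 1 ≤ r := Nat.one_le_ceil_iff.2 (by linarith)
  have hrs : (r : ℝ) ≤ 2 * s := by
    have := Nat.ceil_lt_add_one (show 0 ≤ s by linarith)
    linarith
  have hcard : A.card ≤ (2 * (K * r) + 1) * (2 * (K * r ^ 2) + 1) := by
    calc A.card ≤ ((Finset.Icc (-(K * r : ℤ)) (K * r) ×ˢ
          Finset.Icc (-(K * r ^ 2 : ℤ)) (K * r ^ 2)).image φ).card := by
          refine Finset.card_le_card fun n hn => ?_
          obtain ⟨x, y, h, hx, hy⟩ := hA n hn
          exact Finset.mem_image.2 ⟨(x, y), Finset.mem_product.2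
            ⟨Finset.mem_Icc.2 (abs_le.1 hx), Finset.mem_Icc.2 (abs_le.1 hy)⟩, h⟩
      _ ≤ _ := Finset.card_image_le
      _ = _ := by
          rw [Finset.card_product, Int.card_Icc, Int.card_Icc]
          congr 1
          · rw [show ((K : ℤ) * r + 1 - -(K * r)) = ((2 * (K * r) + 1 : ℕ) : ℤ) by push_cast; ring]
            exact Int.toNat_natCast _
          · rw [show ((K : ℤ) * r ^ 2 + 1 - -(K * r ^ 2)) = ((2 * (K * r ^ 2) + 1 : ℕ) : ℤ) by
              push_cast; ring]
            exact Int.toNat_natCast _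
  have hcard' : A.card ≤ (2 * K + 1) ^ 2 * r ^ 3 := by
    refine hcard.trans ?_
    have h1 : 2 * (K * r) + 1 ≤ (2 * K + 1) * r := by nlinarith
    have h2 : 2 * (K * r ^ 2) + 1 ≤ (2 * K + 1) * r ^ 2 := by nlinarith [Nat.one_le_pow 2 r hr1]
    calc _ ≤ ((2 * K + 1) * r) * ((2 * K + 1) * r ^ 2) := Nat.mul_le_mul h1 h2
      _ = _ := by ring
  have hlog : 0 < Real.log N := Real.log_pos (by linarith)
  have hsl : Real.sqrt (Real.log N) ≤ 2 * s := by
    rw [Real.sqrt_le_left (by positivity)]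
    have := log_le_two_mul_sqrt (show (0 : ℝ) < N by linarith)
    nlinarith
  rw [← mul_div_assoc, le_div_iff₀ (Real.sqrt_pos.2 hlog)]
  have hr3 : (r : ℝ) ^ 3 ≤ (2 * s) ^ 3 := pow_le_pow_left₀ (by positivity) hrs 3
  -- Both `r` and `√(log N)` are at most `2 s`, and `(2 s) ^ 4 = 16 N`.
  calc (A.card : ℝ) * Real.sqrt (Real.log N) ≤ ((2 * K + 1) ^ 2 * (2 * s) ^ 3) * (2 * s) := by
        refine mul_le_mul ?_ hsl (Real.sqrt_nonneg _) (by positivity)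
        calc (A.card : ℝ) ≤ (2 * K + 1) ^ 2 * (r : ℝ) ^ 3 := by exact_mod_cast hcard'
          _ ≤ _ := by gcongr
    _ = 16 * (2 * K + 1) ^ 2 * s ^ 4 := by ring
    _ = _ := by rw [hs4]

theorem card_le_of_affine_rep {D : ℕ} (hD : 0 < D) {a b : ℕ} (ha : 0 < a) :
    ∃ K : ℝ, ∀ N : ℕ, 3 ≤ N → ∀ A : Finset ℤ,
      (∀ n ∈ A, (N : ℤ) ≤ n ∧ n ≤ 2 * N ∧ ∃ u w : ℤ, a * n + b = u ^ 2 + D * w ^ 2) →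
      (A.card : ℝ) ≤ K * (N / Real.sqrt (Real.log N)) := by
  classical
  obtain ⟨K, hK, h⟩ := exists_card_rep_le hD
  refine ⟨K * (2 * a + b : ℕ), fun N hN A hA => ?_⟩
  set c := 2 * a + b with hc
  have hc1 : 1 ≤ c := by omega
  have hNc : N ≤ c * N := Nat.le_mul_of_pos_left N hc1
  have h1 := h (c * N) (by omega)
  have hcard : A.card ≤ ((Finset.Ioc 0 (c * N)).filter
      fun n : ℕ => ∃ u w : ℤ, (n : ℤ) = u ^ 2 + D * w ^ 2).card := by
    have hpos : ∀ n ∈ A, 0 < (a : ℤ) * n + b := fun n hn => by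
      have := (hA n hn).1
      have : 0 < n := by omega
      positivity
    refine Finset.card_le_card_of_injOn (fun n => ((a : ℤ) * n + b).toNat) ?_ ?_
    · intro n hn
      obtain ⟨h1, h2, u, w, huw⟩ := hA n hn
      have h0 := hpos n hn
      simp only [Finset.coe_filter, Finset.mem_Ioc, Set.mem_ofPred_eq]
      refine ⟨⟨by omega, ?_⟩, u, w, by rw [Int.toNat_of_nonneg h0.le, huw]⟩
      zify
      rw [Int.toNat_of_nonneg h0.le, hc]
      push_cast
      have ha' : (0 : ℤ) ≤ a := by positivity
      have hb' : (0 : ℤ) ≤ b := by positivity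
      nlinarith
    · intro n hn m hm hnm
      have h1 := hpos n hn
      have h2 := hpos m hm
      have h3 : (a : ℤ) * n + b = a * m + b := by
        have := congrArg (fun k : ℕ => (k : ℤ)) hnm
        simpa only [Int.toNat_of_nonneg h1.le, Int.toNat_of_nonneg h2.le] using this
      have ha' : (a : ℤ) ≠ 0 := by exact_mod_cast ha.ne'
      exact mul_left_cancel₀ ha' (by linarith)
  have hN3 : (3 : ℝ) ≤ N := by exact_mod_cast hN
  have hlog : 0 < Real.log N := Real.log_pos (by linarith)
  calc (A.card : ℝ) ≤ K * ((c * N : ℕ) / Real.sqrt (Real.log (c * N : ℕ))) :=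
        le_trans (by exact_mod_cast hcard) h1
    _ ≤ K * ((c * N : ℕ) / Real.sqrt (Real.log N)) := by
        have := Real.sqrt_pos.2 hlog
        have h2 : (N : ℝ) ≤ (c * N : ℕ) := by exact_mod_cast hNc
        have h3 : Real.log N ≤ Real.log (c * N : ℕ) := Real.log_le_log (by linarith) h2
        gcongr
    _ = _ := by push_cast; ring

theorem natCast_le_ceil_sqrt_sqrt_pow (N : ℕ) :
    (N : ℤ) ≤ (⌈Real.sqrt (Real.sqrt N)⌉₊ : ℤ) ^ 4 := by
  have hle := Nat.le_ceil (Real.sqrt (Real.sqrt N))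
  have h4 := pow_le_pow_left₀ (Real.sqrt_nonneg _) hle 4
  rw [show Real.sqrt (Real.sqrt N) ^ 4 = (Real.sqrt (Real.sqrt N) ^ 2) ^ 2 by ring,
    Real.sq_sqrt (Real.sqrt_nonneg _), Real.sq_sqrt (by positivity)] at h4
  exact_mod_cast h4

/-! ### The normal form and its completed square -/

/-- The quartic under study in coordinates adapted to the linear form `H`. -/
def normalQuartic (a b c d e f g h : ℤ) (x y : ℤ) : ℤ :=
  a * x ^ 4 + x ^ 2 * (b * x + c * y) + (d * x ^ 2 + e * x * y + f * y ^ 2) + (g * x + h * y)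

theorem four_mul_normalQuartic (a b c d e f g h x y : ℤ) :
    4 * f * normalQuartic a b c d e f g h x y = (2 * f * y + (c * x ^ 2 + e * x + h)) ^ 2 +
      ((4 * f * a - c ^ 2) * x ^ 4 + (4 * f * b - 2 * c * e) * x ^ 3 +
        (4 * f * d - e ^ 2 - 2 * c * h) * x ^ 2 + (4 * f * g - 2 * e * h) * x + -h ^ 2) := by
  unfold normalQuartic
  ring

/-- If `f = 0`, the quartic is affine in `y` with slope `c x ^ 2 + e x + h`; boundedness kills the
slope for every `x`, hence `c = 0`. -/
theorem normalQuartic_sq_coeff_pos {a b c d e f g h B : ℤ} (hc : c ≠ 0)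
    (hB : ∀ x y, B ≤ normalQuartic a b c d e f g h x y) : 0 < f := by
  have hf : 0 ≤ f := quadratic_coeff_nonneg (p₁ := h) (p₀ := -B) fun y => by
    have := hB 0 y
    simp only [normalQuartic] at this
    linarith
  refine hf.lt_of_ne' fun hf0 => hc ?_
  have hlin : ∀ x, c * x ^ 2 + e * x + h = 0 := fun x =>
    linear_coeff_eq_zero (q := a * x ^ 4 + b * x ^ 3 + d * x ^ 2 + g * x - B) fun y => by
      have := hB x y
      simp only [normalQuartic, hf0] at this
      linarith
  have h0 := hlin 0
  have h1 := hlin 1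
  have h2 := hlin (-1)
  norm_num at h0 h1 h2
  omega

theorem exists_card_normalQuartic_le {a b c d e f g h B : ℤ} (hc : c ≠ 0)
    (hB : ∀ x y, B ≤ normalQuartic a b c d e f g h x y) :
    ∃ K : ℝ, ∀ N : ℕ, 3 ≤ N → ∀ A : Finset ℤ,
      (∀ n ∈ A, (N : ℤ) ≤ n ∧ n ≤ 2 * N ∧ ∃ x y, normalQuartic a b c d e f g h x y = n) →
      (A.card : ℝ) ≤ K * (N / Real.sqrt (Real.log N)) := by
  have hf := normalQuartic_sq_coeff_pos hc hB
  have hid := four_mul_normalQuartic a b c d e f g h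
  set p₄ := 4 * f * a - c ^ 2
  set p₃ := 4 * f * b - 2 * c * e
  set p₂ := 4 * f * d - e ^ 2 - 2 * c * h
  set p₁ := 4 * f * g - 2 * e * h
  set E : ℤ := |4 * f ^ 2 - 4 * f * B| with hE
  have hE0 : 0 ≤ E := abs_nonneg _
  -- Taking `y = -(Q / (2 f))` reduces the completed square to `(Q % (2 f)) ^ 2 ≤ 4 f ^ 2`.
  have hP : ∀ x : ℤ, 0 ≤ p₄ * x ^ 4 + p₃ * x ^ 3 + p₂ * x ^ 2 + p₁ * x + (-h ^ 2 + E) := by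
    intro x
    set Q := c * x ^ 2 + e * x + h with hQ
    have h1 := hid x (-(Q / (2 * f)))
    have h2 := hB x (-(Q / (2 * f)))
    have h3 : 2 * f * -(Q / (2 * f)) + Q = Q % (2 * f) := by
      rw [Int.emod_def]; ring
    rw [← hQ, h3] at h1
    have h4 := Int.emod_nonneg Q (show 2 * f ≠ 0 by omega)
    have h5 := Int.emod_lt_of_pos Q (show 0 < 2 * f by omega)
    have h6 : (Q % (2 * f)) ^ 2 ≤ (2 * f) ^ 2 := pow_le_pow_left₀ h4 h5.le 2
    have h7 := mul_le_mul_of_nonneg_left h2 (show 0 ≤ 4 * f by omega)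
    have h8 := le_abs_self (4 * f ^ 2 - 4 * f * B)
    rw [← hE] at h8
    nlinarith
  have hp₄ := quartic_coeff_nonneg hP
  set S : ℤ := 8 * f + |p₃| + |p₂| + |p₁| + |-h ^ 2| + 1 + E with hS
  have hS0 : 0 ≤ S := by positivity
  -- The value depends only on `Z` and `P(x)`, so `x` may be replaced by a small `x'` with the same
  -- `P`: `x` itself when `p₄ > 0`, and `0` when `P` is constant.
  have hbox : (∀ N : ℕ, 3 ≤ N → ∀ n x y : ℤ, n ≤ 2 * N → normalQuartic a b c d e f g h x y = n →
      ∃ x' : ℤ, |x'| ≤ S * (⌈Real.sqrt (Real.sqrt N)⌉₊ : ℤ) ∧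
        p₄ * x ^ 4 + p₃ * x ^ 3 + p₂ * x ^ 2 + p₁ * x =
          p₄ * x' ^ 4 + p₃ * x' ^ 3 + p₂ * x' ^ 2 + p₁ * x') →
      ∃ K : ℝ, ∀ N : ℕ, 3 ≤ N → ∀ A : Finset ℤ,
        (∀ n ∈ A, (N : ℤ) ≤ n ∧ n ≤ 2 * N ∧ ∃ x y, normalQuartic a b c d e f g h x y = n) →
        (A.card : ℝ) ≤ K * (N / Real.sqrt (Real.log N)) := by
    intro hx'
    refine ⟨16 * (2 * S.toNat + 1) ^ 2, fun N hN A hA => ?_⟩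
    refine card_le_of_subset_image_box (by omega) (fun z => (z.2 ^ 2 + (p₄ * z.1 ^ 4 +
      p₃ * z.1 ^ 3 + p₂ * z.1 ^ 2 + p₁ * z.1 + -h ^ 2)) / (4 * f)) A fun n hn => ?_
    obtain ⟨-, hn2, x, y, hxy⟩ := hA n hn
    obtain ⟨x', hx1, hx2⟩ := hx' N hN n x y hn2 hxy
    have h1 := hid x y
    rw [hxy] at h1
    set Z := 2 * f * y + (c * x ^ 2 + e * x + h)
    refine ⟨x', Z, ?_, by rwa [Int.toNat_of_nonneg hS0], ?_⟩
    · rw [← hx2, ← h1]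
      exact Int.mul_ediv_cancel_left n (by omega)
    · rw [Int.toNat_of_nonneg hS0]
      have hNr := natCast_le_ceil_sqrt_sqrt_pow N
      set r : ℤ := (⌈Real.sqrt (Real.sqrt N)⌉₊ : ℤ)
      have hr0 : 0 ≤ r := by positivity
      have h2 := hP x
      have hN1 : (1 : ℤ) ≤ N := by omega
      have hZ : Z ^ 2 ≤ (8 * f + E) * r ^ 4 := by nlinarith
      have hS1 : 8 * f + E ≤ S := by
        have : 0 ≤ |p₃| + |p₂| + |p₁| + |-h ^ 2| := by positivity
        omega
      have hS2 : 8 * f + E ≤ S ^ 2 := by nlinarith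
      refine abs_le_of_sq_le_sq ?_ (by positivity)
      calc Z ^ 2 ≤ (8 * f + E) * r ^ 4 := hZ
        _ ≤ S ^ 2 * r ^ 4 := mul_le_mul_of_nonneg_right hS2 (by positivity)
        _ = _ := by ring
  rcases hp₄.eq_or_lt with h4 | h4
  · rw [← h4] at hP hid hbox
    have h3 : p₃ = 0 := cubic_coeff_eq_zero (p₂ := p₂) (p₁ := p₁) (p₀ := -h ^ 2 + E)
      fun x => by linarith [hP x]
    rw [h3] at hP hid hbox
    have h2 : 0 ≤ p₂ := quadratic_coeff_nonneg (p₁ := p₁) (p₀ := -h ^ 2 + E)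
      fun x => by linarith [hP x]
    rcases h2.eq_or_lt with h2 | h2
    · rw [← h2] at hP hid hbox
      have h1 : p₁ = 0 := linear_coeff_eq_zero (q := -h ^ 2 + E) fun x => by linarith [hP x]
      rw [h1] at hbox
      exact hbox fun N hN n x y _ _ => ⟨0, by simpa using by positivity, by ring⟩
    -- Multiplying `4 f n = Z ^ 2 + p₂ x ^ 2 + p₁ x - h ^ 2` by `4 p₂` completes the square in `x`,
    -- with `D = p₂`.
    · obtain ⟨K, hK⟩ := card_le_of_affine_rep (D := p₂.toNat) (a := (16 * p₂ * f).toNat)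
        (b := (p₁ ^ 2 + 4 * p₂ * h ^ 2).toNat) (by omega)
        (by have : 0 < 16 * p₂ * f := by positivity
            omega)
      refine ⟨K, fun N hN A hA => hK N hN A fun n hn => ?_⟩
      obtain ⟨hn1, hn2, x, y, hxy⟩ := hA n hn
      refine ⟨hn1, hn2, 2 * p₂ * x + p₁, 2 * (2 * f * y + (c * x ^ 2 + e * x + h)), ?_⟩
      rw [Int.toNat_of_nonneg (by positivity), Int.toNat_of_nonneg (by positivity),
        Int.toNat_of_nonneg h2.le]
      have h1 := hid x y
      rw [hxy] at h1
      linear_combination 4 * p₂ * h1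
  · refine hbox fun N hN n x y hn hxy => ⟨x, ?_, rfl⟩
    have h1 := hid x y
    rw [hxy] at h1
    have hNr := natCast_le_ceil_sqrt_sqrt_pow N
    set r : ℤ := (⌈Real.sqrt (Real.sqrt N)⌉₊ : ℤ)
    have hr0 : 0 ≤ r := by positivity
    have hr1 : 1 ≤ r := by
      by_contra! hr
      have : r = 0 := by omega
      rw [this] at hNr
      norm_num at hNr
      omega
    have h5 : p₄ * x ^ 4 + p₃ * x ^ 3 + p₂ * x ^ 2 + p₁ * x + -h ^ 2 ≤ (8 * f) * r ^ 4 := by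
      have := sq_nonneg (2 * f * y + (c * x ^ 2 + e * x + h))
      nlinarith
    refine (abs_le_mul_of_quartic_le h4 (by omega) hr1 h5).trans ?_
    exact mul_le_mul_of_nonneg_right (by omega) hr0

/-! ### Binary forms and the unimodular change of variables -/

theorem MvPolynomial.IsHomogeneous.eq_sum_fin_two {R : Type*} [CommSemiring R] {n : ℕ}
    {G : MvPolynomial (Fin 2) R} (hG : G.IsHomogeneous n) :
    G = ∑ i ∈ Finset.range (n + 1),
      C (G.coeff (Finsupp.single 0 i + Finsupp.single 1 (n - i))) * (X 0 ^ i * X 1 ^ (n - i)) := by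
  have hmon : ∀ (i j : ℕ) (r : R), C r * (X 0 ^ i * X 1 ^ j : MvPolynomial (Fin 2) R) =
      monomial (Finsupp.single 0 i + Finsupp.single 1 j) r := fun i j r => by
    rw [X_pow_eq_monomial, X_pow_eq_monomial, monomial_mul, C_mul_monomial]
    simp
  simp only [hmon]
  ext m
  rw [coeff_sum]
  simp only [coeff_monomial]
  have hm : m = Finsupp.single 0 (m 0) + Finsupp.single 1 (m 1) := by
    ext i
    fin_cases i <;> simp
  by_cases hdeg : m 0 + m 1 = n
  · rw [Finset.sum_eq_single (m 0)]
    · rw [← hdeg, Nat.add_sub_cancel_left, ← hm, if_pos rfl]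
    · intro i _ hi
      refine if_neg fun h => hi ?_
      simpa using DFunLike.congr_fun h 0
    · intro h
      exact absurd (Finset.mem_range.2 (by omega)) h
  · rw [hG.coeff_eq_zero, Finset.sum_eq_zero]
    · intro i hi
      refine if_neg fun h => hdeg ?_
      rw [Finset.mem_range] at hi
      rw [← h]
      simp
      omega
    · rw [Finsupp.degree_eq_sum]
      simpa using hdeg

theorem exists_linear_form {G : MvPolynomial (Fin 2) ℤ} (hG : G.IsHomogeneous 1) :
    ∃ α β : ℤ, G = C α * X 0 + C β * X 1 := by
  have h := hG.eq_sum_fin_two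
  rw [Finset.sum_range_succ, Finset.sum_range_one, add_comm] at h
  simp only [pow_zero, pow_one, Nat.sub_self, Nat.sub_zero, mul_one, one_mul] at h
  exact ⟨_, _, h⟩

theorem exists_quadratic_form {G : MvPolynomial (Fin 2) ℤ} (hG : G.IsHomogeneous 2) :
    ∃ α β γ : ℤ, G = C α * X 0 ^ 2 + C β * (X 0 * X 1) + C γ * X 1 ^ 2 := by
  have h := hG.eq_sum_fin_two
  rw [Finset.sum_range_succ, Finset.sum_range_succ, Finset.sum_range_one] at h
  simp only [pow_zero, pow_one, Nat.sub_self, Nat.sub_zero, mul_one, one_mul] at h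
  rw [add_comm, add_comm (C _ * X 1 ^ 2), ← add_assoc, show 2 - 1 = 1 from rfl, pow_one] at h
  exact ⟨_, _, _, h⟩

theorem isCoprime_of_isPrimitiveForm {α β : ℤ}
    (h : IsPrimitiveForm (C α * X 0 + C β * X 1)) : IsCoprime α β := by
  rw [Int.isCoprime_iff_gcd_eq_one]
  have hdvd : C ((Int.gcd α β : ℕ) : ℤ) ∣
      (C α * X 0 + C β * X 1 : MvPolynomial (Fin 2) ℤ) :=
    dvd_add ((map_dvd C (Int.gcd_dvd_left α β)).mul_right _)
      ((map_dvd C (Int.gcd_dvd_right α β)).mul_right _)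
  have h1 : ((Int.gcd α β : ℕ) : ℤ) ∣ 1 := by
    unfold IsPrimitiveForm at h
    rw [← h]
    exact Finset.dvd_gcd fun m _ => C_dvd_iff_dvd_coeff _ _ |>.1 hdvd m
  exact_mod_cast Int.eq_one_of_dvd_one (by positivity) h1

theorem exists_range_eq_normalQuartic {F H G₃ F₂ F₁ : MvPolynomial (Fin 2) ℤ} {a₄ : ℕ}
    (hH : H.IsHomogeneous 1) (hHprim : IsPrimitiveForm H)
    (hG₃ : G₃.IsHomogeneous 1) (hHG₃ : ¬ H ∣ G₃)
    (hF₂ : F₂.IsHomogeneous 2) (hF₁ : F₁.IsHomogeneous 1)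
    (hF : F = C (a₄ : ℤ) * H ^ 4 + H ^ 2 * G₃ + F₂ + F₁) :
    ∃ a b c d e f g h : ℤ, c ≠ 0 ∧ ∀ n : ℤ, n ∈ Set.range (intValue F) ↔
      ∃ x y, normalQuartic a b c d e f g h x y = n := by
  obtain ⟨α, β, rfl⟩ := exists_linear_form hH
  obtain ⟨g₁, g₂, rfl⟩ := exists_linear_form hG₃
  obtain ⟨q₁, q₂, q₃, rfl⟩ := exists_quadratic_form hF₂
  obtain ⟨l₁, l₂, rfl⟩ := exists_linear_form hF₁
  -- The Bézout relation is the determinant of the substitution `(δ u - β v, γ u + α v)`, under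
  -- which `H` becomes `u`.
  obtain ⟨δ, γ, hdet⟩ := isCoprime_of_isPrimitiveForm hHprim
  have hval : ∀ u v : ℤ, intValue F (δ * u - β * v, γ * u + α * v) =
      normalQuartic a₄ (g₁ * δ + g₂ * γ) (-g₁ * β + g₂ * α)
        (q₁ * δ ^ 2 + q₂ * δ * γ + q₃ * γ ^ 2)
        (-2 * q₁ * δ * β + q₂ * (δ * α - β * γ) + 2 * q₃ * γ * α)
        (q₁ * β ^ 2 - q₂ * β * α + q₃ * α ^ 2)
        (l₁ * δ + l₂ * γ) (-l₁ * β + l₂ * α) u v := by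
    intro u v
    have hu : α * (δ * u - β * v) + β * (γ * u + α * v) = u := by
      linear_combination u * hdet
    simp only [intValue, hF, map_add, map_mul, map_pow, eval_C, eval_X, Matrix.cons_val_zero,
      Matrix.cons_val_one, hu, normalQuartic]
    ring
  -- Here `c = G₃(-β, α)`; its vanishing would give `G₃ = G₃(δ, γ) * H`.
  refine ⟨_, _, _, _, _, _, _, _, fun hc => hHG₃ ⟨C (g₁ * δ + g₂ * γ), ?_⟩, fun n =>
    ⟨?_, fun ⟨u, v, huv⟩ => ⟨_, (hval u v).trans huv⟩⟩⟩
  · have h1 : g₁ = α * (g₁ * δ + g₂ * γ) := by linear_combination -g₁ * hdet - γ * hc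
    have h2 : g₂ = β * (g₁ * δ + g₂ * γ) := by linear_combination -g₂ * hdet + δ * hc
    have h1' := congrArg (C (σ := Fin 2)) h1
    have h2' := congrArg (C (σ := Fin 2)) h2
    rw [map_mul] at h1' h2'
    linear_combination X 0 * h1' + X 1 * h2'
  · rintro ⟨⟨x, y⟩, rfl⟩
    refine ⟨α * x + β * y, -γ * x + δ * y, ?_⟩
    rw [← hval]
    congr 2
    · linear_combination x * hdet
    · linear_combination y * hdet

theorem proposition4p2 (F H G₃ F₂ F₁ : MvPolynomial (Fin 2) ℤ) (a₄ : ℕ)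
    (ha₄ : 0 < a₄)
    (hH : H.IsHomogeneous 1) (hHprim : IsPrimitiveForm H)
    (hG₃ : G₃.IsHomogeneous 1) (hHG₃ : ¬ H ∣ G₃)
    (hF₂ : F₂.IsHomogeneous 2) (hF₁ : F₁.IsHomogeneous 1)
    (hF : F = C (a₄ : ℤ) * H ^ 4 + H ^ 2 * G₃ + F₂ + F₁) :
    ((fun N : ℕ => ((valuesIn F (Set.Icc (N : ℝ) (2 * N))).ncard : ℝ))
        =O[atTop] fun N : ℕ => (N : ℝ) / Real.sqrt (Real.log N)) ∨
      ¬ BddBelow (Set.range (intValue F)) := by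
  refine or_iff_not_imp_right.2 fun hbdd => ?_
  rw [not_not] at hbdd
  obtain ⟨B, hB⟩ := hbdd
  obtain ⟨a, b, c, d, e, f, g, h, hc, hrange⟩ :=
    exists_range_eq_normalQuartic hH hHprim hG₃ hHG₃ hF₂ hF₁ hF
  obtain ⟨K, hK⟩ := exists_card_normalQuartic_le (a := a) (b := b) (d := d) (e := e) (f := f)
    (g := g) (h := h) hc fun x y => hB ((hrange _).2 ⟨x, y, rfl⟩)
  refine IsBigO.of_bound K ?_
  filter_upwards [eventually_ge_atTop 3] with N hN
  have hfin : (Set.range (intValue F) ∩ Set.Icc (N : ℤ) (2 * N)).Finite :=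
    (Set.finite_Icc _ _).inter_of_right _
  have hval : valuesIn F (Set.Icc (N : ℝ) (2 * N)) =
      (fun n : ℤ => (n : ℝ)) '' (Set.range (intValue F) ∩ Set.Icc (N : ℤ) (2 * N)) := by
    ext z
    constructor
    · rintro ⟨⟨p, rfl⟩, h1, h2⟩
      exact ⟨_, ⟨⟨p, rfl⟩, (Int.cast_le (R := ℝ)).1 (by simpa using h1),
        (Int.cast_le (R := ℝ)).1 (by simpa using h2)⟩, rfl⟩
    · rintro ⟨_, ⟨⟨p, rfl⟩, h1, h2⟩, rfl⟩
      exact ⟨⟨p, rfl⟩, by simpa using (Int.cast_le (R := ℝ)).2 h1,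
        by simpa using (Int.cast_le (R := ℝ)).2 h2⟩
  rw [hval, Set.ncard_image_of_injective _ Int.cast_injective, Set.ncard_eq_toFinset_card _ hfin,
    Real.norm_of_nonneg (by positivity), Real.norm_of_nonneg (by positivity)]
  refine hK N hN _ fun n hn => ?_
  rw [Set.Finite.mem_toFinset] at hn
  exact ⟨hn.2.1, hn.2.2, (hrange n).1 hn.1⟩
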